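/- Let $G$ be a finite simple graph. An arc of $G$ is an ordered pair $a=(u,v)$ of adjacent vertices, with origin $u$, terminus $t(a)=v$ and inverse arc $a^{-1}=(v,u)$. Define complex matrices, with $S$ and $K$ indexed by arcs $\times$ arcs and $N$ by vertices $\times$ arcs, by $$S_{ab}=\delta_{a,b^{-1}},\qquad N_{ua}=\frac{1}{\sqrt{\deg u}}\,\delta_{u,t(a)},\qquad K=2N^*N-I,\qquad U=SK .$$ For a vertex $u$ let $\mathbf e_u$ be the corresponding standard basis vector and put $\Phi_u=N^*\mathbf e_u$. The graph $G$ exhibits (Grover) perfect state transfer if there are distinct vertices $u\neq v$, a positive integer $\tau$ and a complex number $\gamma$ with $|\gamma|=1$ such that $U^\tau\Phi_u=\gamma\,\Phi_v$. The graph $G$ is integral if all eigenvalues of its adjacency matrix are integers. It is distance-regular if it is connected and, for any vertices $u,v$ and any $i,j$, the number of vertices at distance $i$ from $u$ and distance $j$ from $v$ depends only on $i$, $j$ and the distance between $u$ and $v$. **Theorem.** Let $G$ be an integral distance-regular graph. Then $G$ exhibits perfect state transfer if and only if $G$ is isomorphic to one of the complete graph $K_2$, the cycle $C_4$, the cycle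 $C_6$, and the complete tripartite graph $K_{2,2,2}$. -/

import Mathlib

open scoped Matrix

namespace SimpleGraph

noncomputable section

variable {V : Type*} [Fintype V] [DecidableEq V] (G : SimpleGraph V) [DecidableRel G.Adj]

/-- The shift matrix `S` on the arcs of `G`: `S a b = 1` if `a` is the inverse arc of `b`,
and `0` otherwise. The arc `(u, v)` is the dart with origin `fst = u` and terminus `snd = v`. -/
def shiftMatrix : Matrix G.Dart G.Dart ℂ :=
  Matrix.of fun a b => if a = b.symm then 1 else 0

/-- The boundary matrix `N`, with `N u a = 1 / √(deg u)` if `u` is the terminus of the arc `a`,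
and `0` otherwise. -/
def boundaryMatrix : Matrix V G.Dart ℂ :=
  Matrix.of fun u a => if u = a.snd then 1 / ((Real.sqrt (G.degree u) : ℝ) : ℂ) else 0

/-- The coin matrix `K = 2 N* N - I`. -/
def coinMatrix : Matrix G.Dart G.Dart ℂ :=
  (2 : ℂ) • (G.boundaryMatrixᴴ * G.boundaryMatrix) - 1

/-- The time evolution matrix `U = S K` of the Grover walk on `G`. -/
def groverMatrix : Matrix G.Dart G.Dart ℂ :=
  G.shiftMatrix * G.coinMatrix

/-- The vertex-type state `Φ_u = N* e_u`. -/
def vertexState (u : V) : G.Dart → ℂ :=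
  G.boundaryMatrixᴴ *ᵥ Pi.single u 1

/-- Perfect state transfer in the Grover walk on `G` from the vertex `u` to another vertex `v`
at time `τ`. -/
def PerfectStateTransferAt (u v : V) (τ : ℕ) : Prop :=
  u ≠ v ∧ 0 < τ ∧
    ∃ γ : ℂ, ‖γ‖ = 1 ∧ (G.groverMatrix ^ τ) *ᵥ G.vertexState u = γ • G.vertexState v

/-- `G` exhibits perfect state transfer (in the Grover walk). -/
def HasGroverPST : Prop :=
  ∃ u v : V, ∃ τ : ℕ, G.PerfectStateTransferAt u v τ

/-- A graph is integral if all eigenvalues of its adjacency matrix are integers. -/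
def IsIntegralGraph : Prop :=
  ∀ μ : ℂ, Module.End.HasEigenvalue (Matrix.toLin' (G.adjMatrix ℂ)) μ → ∃ m : ℤ, μ = m

end

/-- A distance-regular graph: a connected graph in which the number of vertices at distance `i`
from `u` and distance `j` from `v` depends only on `i`, `j` and the distance between `u`
and `v`. -/
def IsDistanceRegular {V : Type*} [Fintype V] (G : SimpleGraph V) : Prop :=
  G.Connected ∧ ∀ i j : ℕ, ∀ u v u' v' : V, G.dist u v = G.dist u' v' →
    (Finset.univ.filter fun w => G.dist u w = i ∧ G.dist v w = j).card =
      (Finset.univ.filter fun w => G.dist u' w = i ∧ G.dist v' w = j).card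

end SimpleGraph

/-! Let `k` be the valency and `P = A / k`. The relation `N U^n N* = T_n(P)`, with Chebyshev
polynomials `T_n`, turns transfer at time `τ` into a statement about `M = T_τ(P)`: its column at `u`
is `γ e_v`. The entries of `M` depend only on distance, so this one column determines `M`. It is `γ`
times the permutation matrix of a fixed-point-free involution `q`, and the all-ones vector gives `γ
= 1` (`IsDistanceRegular.exists_involutive`).

Thus `M² = 1`, so `T_τ(μ) = ±1` at every eigenvalue `μ` of `P`. Since `μ` is rational, Niven's
theorem leaves `μ ∈ {0, ±1/2, ±1}`. On these values `T_τ` agrees with simple expressions, which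
become matrix identities because `P` is Hermitian. For even `τ`, `P (M - 1) = 0`: `y` and `q y` are
twins, `G` is a cocktail party graph, and its eigenvalue `-2 / k` forces `k = 2` or `k = 4`. For odd
`τ`, `M P = 2 P² - 1`: either `q x` is adjacent to `x` and `G` is `K_2`, or the diagonal gives `k =
2` and the other entries give the hexagon.

Conversely, `T_1`, `T_2`, `T_3`, `T_6` of the four normalized adjacency matrices are computed
explicitly; unitarity of `U` lifts the result from vertices to arcs. -/

open scoped Matrix
open Polynomial

/-! ### Chebyshev values at rational points -/

namespace Polynomial.Chebyshev

/-- The values of the Chebyshev polynomials at `1 / 2` are periodic. -/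
theorem eval_T_half_cases (n : ℕ) :
    (Even n ∧ (T ℂ n).eval (1 / 2) = 1 ∧ (T ℂ (n + 1)).eval (1 / 2) = 1 / 2) ∨
    (Odd n ∧ (T ℂ n).eval (1 / 2) = 1 / 2 ∧ (T ℂ (n + 1)).eval (1 / 2) = -1 / 2) ∨
    (Even n ∧ (T ℂ n).eval (1 / 2) = -1 / 2 ∧ (T ℂ (n + 1)).eval (1 / 2) = -1) ∨
    (Odd n ∧ (T ℂ n).eval (1 / 2) = -1 ∧ (T ℂ (n + 1)).eval (1 / 2) = -1 / 2) ∨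
    (Even n ∧ (T ℂ n).eval (1 / 2) = -1 / 2 ∧ (T ℂ (n + 1)).eval (1 / 2) = 1 / 2) ∨
    (Odd n ∧ (T ℂ n).eval (1 / 2) = 1 / 2 ∧ (T ℂ (n + 1)).eval (1 / 2) = 1) := by
  induction n with
  | zero => simp
  | succ n ih =>
    -- At `1 / 2` the factor `2 X` is `1`. The resulting recurrence has period six, an even number,
    -- so each state fixes the parity of the index.
    have h : (T ℂ ((n + 1 : ℕ) + 1 : ℤ)).eval (1 / 2)
        = (T ℂ (n + 1)).eval (1 / 2) - (T ℂ n).eval (1 / 2) := by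
      have := congrArg (eval (1 / 2 : ℂ)) (T_add_two ℂ n)
      simp only [eval_sub, eval_mul, eval_X, eval_ofNat] at this
      push_cast
      rw [add_assoc, one_add_one_eq_two, this]
      ring
    have h' : (T ℂ ((n + 1 : ℕ) : ℤ)) = T ℂ (n + 1) := by push_cast; rfl
    rw [h, h']
    rcases ih with ⟨e, a, b⟩ | ⟨e, a, b⟩ | ⟨e, a, b⟩ | ⟨e, a, b⟩ | ⟨e, a, b⟩ | ⟨e, a, b⟩ <;>
      rw [a, b] <;> simp only [Nat.even_add_one, Nat.odd_add_one, Nat.not_even_iff_odd,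
        Nat.not_odd_iff_even, e, true_and] <;> norm_num

theorem eval_T_half_of_sq_eq_one {n : ℕ} (h : (T ℂ n).eval (1 / 2) ^ 2 = 1) :
    (T ℂ n).eval (1 / 2) = (-1) ^ n := by
  rcases eval_T_half_cases n with ⟨e, a, -⟩ | ⟨e, a, -⟩ | ⟨e, a, -⟩ | ⟨e, a, -⟩ | ⟨e, a, -⟩ |
    ⟨e, a, -⟩ <;> rw [a] at h ⊢ <;> first | (simp [e.neg_one_pow]; done) | norm_num at h

theorem negOnePow_natCast (n : ℕ) : (((n : ℤ).negOnePow : ℤ) : ℂ) = (-1) ^ n := by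
  simp [Int.negOnePow_def]

theorem eval_T_neg_half_of_sq_eq_one {n : ℕ} (h : (T ℂ n).eval (-(1 / 2)) ^ 2 = 1) :
    (T ℂ n).eval (-(1 / 2)) = 1 := by
  rw [T_eval_neg, negOnePow_natCast] at h ⊢
  rw [mul_pow, ← pow_mul, mul_comm n, pow_mul, neg_one_sq, one_pow, one_mul] at h
  rw [eval_T_half_of_sq_eq_one h, ← mul_pow]
  simp

/-- A rational point at which some Chebyshev polynomial takes one of the values `1` and `-1` is
one of `0`, `± 1 / 2`, `± 1`. -/
theorem mem_of_eval_T_sq_eq_one {n : ℕ} (hn : 0 < n) {q : ℚ}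
    (h : (T ℂ n).eval (q : ℂ) ^ 2 = 1) :
    (q : ℂ) = -1 ∨ (q : ℂ) = -(1 / 2) ∨ (q : ℂ) = 0 ∨ (q : ℂ) = 1 / 2 ∨ (q : ℂ) = 1 := by
  obtain ⟨θ, hθ⟩ := Complex.cos_surjective (q : ℂ)
  rw [← hθ, T_complex_cos] at h
  have hs : Complex.sin (n * θ) = 0 := by
    have := Complex.sin_sq_add_cos_sq (n * θ)
    push_cast at h
    rw [h] at this
    simpa using this
  obtain ⟨m, hm⟩ := Complex.sin_eq_zero_iff.1 hs
  have hn' : (n : ℂ) ≠ 0 := by exact_mod_cast hn.ne'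
  -- The a priori complex angle is real, being a rational multiple of `π`, as Niven's theorem needs.
  have hθ' : θ = (((m / n : ℚ) : ℝ) * Real.pi : ℝ) := by
    push_cast
    field_simp
    rw [mul_comm, hm]
  have hc : Real.cos (((m / n : ℚ) : ℝ) * Real.pi) = (q : ℝ) := by
    rw [hθ', ← Complex.ofReal_cos] at hθ
    exact_mod_cast hθ
  have key := niven ⟨_, rfl⟩ ⟨q, hc⟩
  rw [hc] at key
  simp only [Set.mem_insert_iff, Set.mem_singleton_iff] at key
  rcases key with h | h | h | h | h
  · left; exact_mod_cast congrArg (Complex.ofReal) h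
  · right; left; have := congrArg (Complex.ofReal) h; push_cast at this; rw [this]; ring
  · right; right; left; exact_mod_cast congrArg (Complex.ofReal) h
  · right; right; right; left; have := congrArg (Complex.ofReal) h; push_cast at this; exact this
  · right; right; right; right; exact_mod_cast congrArg (Complex.ofReal) h

theorem mul_eval_T_sub_one_of_even {n : ℕ} (hn : 0 < n) (he : Even n) {q : ℚ}
    (h : (T ℂ n).eval (q : ℂ) ^ 2 = 1) : (q : ℂ) * ((T ℂ n).eval (q : ℂ) - 1) = 0 := by
  rcases mem_of_eval_T_sq_eq_one hn h with hq | hq | hq | hq | hq <;> rw [hq] at h ⊢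
  · rw [T_eval_neg_one, negOnePow_natCast, he.neg_one_pow]; ring
  · rw [eval_T_neg_half_of_sq_eq_one h]; ring
  · ring
  · rw [eval_T_half_of_sq_eq_one h, he.neg_one_pow]; ring
  · rw [T_eval_one]; ring

/-- An odd `T_n` vanishes at `0`, which leaves `±1/2` and `±1`, the roots of the quartic. There
`T_n` agrees with `T_3 = 4 X³ - 3 X`; together the two equations give `q T_n(q) = 2 q² - 1`. -/
theorem eval_T_of_odd {n : ℕ} (hn : 0 < n) (ho : Odd n) {q : ℚ}
    (h : (T ℂ n).eval (q : ℂ) ^ 2 = 1) :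
    (T ℂ n).eval (q : ℂ) = 4 * (q : ℂ) ^ 3 - 3 * q ∧ 4 * (q : ℂ) ^ 4 - 5 * (q : ℂ) ^ 2 + 1 = 0 := by
  rcases mem_of_eval_T_sq_eq_one hn h with hq | hq | hq | hq | hq <;> rw [hq] at h ⊢
  · rw [T_eval_neg_one, negOnePow_natCast, ho.neg_one_pow]; norm_num
  · rw [eval_T_neg_half_of_sq_eq_one h]; norm_num
  · rw [T_eval_zero_of_odd ℂ (by exact_mod_cast ho)] at h
    norm_num at h
  · rw [eval_T_half_of_sq_eq_one h, ho.neg_one_pow]; norm_num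
  · rw [T_eval_one]; norm_num

end Polynomial.Chebyshev

/-! ### Polynomials in a Hermitian matrix -/

namespace Matrix

variable {n : Type*} [Fintype n] [DecidableEq n]

theorem aeval_mulVec_of_mulVec_eq_smul {M : Matrix n n ℂ} {x : n → ℂ} {μ : ℂ}
    (h : M *ᵥ x = μ • x) (p : ℂ[X]) : aeval M p *ᵥ x = p.eval μ • x := by
  induction p using Polynomial.induction_on' with
  | add p q hp hq => rw [map_add, add_mulVec, hp, hq, eval_add, add_smul]
  | monomial m a =>
    have : ∀ m : ℕ, (M ^ m) *ᵥ x = μ ^ m • x := by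
      intro m
      induction m with
      | zero => simp
      | succ m ih => rw [pow_succ, ← mulVec_mulVec, h, mulVec_smul, ih, smul_smul, pow_succ']
    rw [aeval_monomial, ← Algebra.smul_def, smul_mulVec, this, eval_monomial, smul_smul]

/-- A polynomial that vanishes at all eigenvalues of a Hermitian matrix vanishes at the matrix. -/
theorem IsHermitian.aeval_eq_zero {M : Matrix n n ℂ} (hM : M.IsHermitian) (p : ℂ[X])
    (h : ∀ μ : ℂ, ∀ x : n → ℂ, x ≠ 0 → M *ᵥ x = μ • x → p.eval μ = 0) : aeval M p = 0 := by
  have hz : aeval M p * (hM.eigenvectorUnitary : Matrix n n ℂ) = 0 := by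
    ext i j
    have hj : M *ᵥ ⇑(hM.eigenvectorBasis j)
        = (hM.eigenvalues j : ℂ) • ⇑(hM.eigenvectorBasis j) := by
      rw [hM.mulVec_eigenvectorBasis j]
      ext; simp
    have h0 : (⇑(hM.eigenvectorBasis j) : n → ℂ) ≠ 0 := by
      intro h0
      refine hM.eigenvectorBasis.orthonormal.ne_zero j ?_
      ext i
      exact congrFun h0 i
    have := aeval_mulVec_of_mulVec_eq_smul hj p
    rw [h _ _ h0 hj, zero_smul] at this
    exact congrFun this i
  have := congrArg (· * star (hM.eigenvectorUnitary : Matrix n n ℂ)) hz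
  simpa [mul_assoc] using this

end Matrix

namespace SimpleGraph

/-! ### The Grover walk on a regular graph -/

section GroverWalk

variable {V : Type*} [Fintype V] [DecidableEq V] (G : SimpleGraph V) [DecidableRel G.Adj]

theorem dart_snd_fiber_card_eq_degree (v : V) :
    (Finset.univ.filter fun d : G.Dart => d.snd = v).card = G.degree v := by
  rw [← G.dart_fst_fiber_card_eq_degree v]
  refine Finset.card_bij (fun d _ => d.symm) (by simp) (fun a _ b _ h => ?_) fun b hb => ?_
  · simpa using congrArg Dart.symm h
  · exact ⟨b.symm, by simpa using hb, by simp⟩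

theorem shiftMatrix_mul_apply {ι : Type*} (M : Matrix G.Dart ι ℂ) (a : G.Dart) (i : ι) :
    (G.shiftMatrix * M) a i = M a.symm i := by
  rw [Matrix.mul_apply, Finset.sum_eq_single a.symm]
  · simp [shiftMatrix]
  · intro b _ hb
    have : a ≠ b.symm := fun h => hb (by rw [h, Dart.symm_symm])
    simp [shiftMatrix, this]
  · simp

theorem shiftMatrix_mul_self : G.shiftMatrix * G.shiftMatrix = 1 := by
  ext a b
  rw [shiftMatrix_mul_apply]
  by_cases h : a = b
  · subst h
    simp [shiftMatrix]
  · have : a.symm ≠ b.symm := fun h' => h (by simpa using congrArg Dart.symm h')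
    simp [shiftMatrix, h, this]

omit [Fintype V] [DecidableRel G.Adj] in
theorem conjTranspose_shiftMatrix : G.shiftMatrixᴴ = G.shiftMatrix := by
  ext a b
  have : b = a.symm ↔ a = b.symm := ⟨fun h => by simp [h], fun h => by simp [h]⟩
  simp [shiftMatrix, Matrix.conjTranspose_apply, this, apply_ite]

variable {G} {k : ℕ}

theorem boundaryMatrix_mul_conjTranspose (hk : 0 < k) (hG : G.IsRegularOfDegree k) :
    G.boundaryMatrix * G.boundaryMatrixᴴ = 1 := by
  ext u v
  have hk' : ((Real.sqrt k : ℝ) : ℂ) * ((Real.sqrt k : ℝ) : ℂ) = k := by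
    rw [← Complex.ofReal_mul, Real.mul_self_sqrt (by positivity)]; simp
  have hk0 : (k : ℂ) ≠ 0 := by exact_mod_cast hk.ne'
  have hs : ((Real.sqrt k : ℝ) : ℂ) ≠ 0 := fun h => hk0 (by rw [← hk', h, zero_mul])
  rw [Matrix.mul_apply]
  simp only [boundaryMatrix, Matrix.conjTranspose_apply, Matrix.of_apply, hG.degree_eq]
  by_cases h : u = v
  · subst h
    have : ∀ d : G.Dart, ((if u = d.snd then 1 / ((Real.sqrt k : ℝ) : ℂ) else 0) *
        star (if u = d.snd then 1 / ((Real.sqrt k : ℝ) : ℂ) else 0) : ℂ)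
        = if d.snd = u then (k : ℂ)⁻¹ else 0 := by
      intro d
      by_cases hd : u = d.snd
      · rw [if_pos hd, if_pos hd.symm, ← hk']
        simp
      · rw [if_neg hd, if_neg (Ne.symm hd), zero_mul]
    rw [Finset.sum_congr rfl fun d _ => this d, ← Finset.sum_filter, Finset.sum_const,
      dart_snd_fiber_card_eq_degree, hG.degree_eq, Matrix.one_apply_eq, nsmul_eq_mul,
      mul_inv_cancel₀ hk0]
  · rw [Matrix.one_apply_ne h]
    refine Finset.sum_eq_zero fun d _ => ?_
    by_cases hd : u = d.snd
    · rw [if_neg (fun h' : v = d.snd => h (hd.trans h'.symm)), star_zero, mul_zero]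
    · rw [if_neg hd, zero_mul]

theorem boundaryMatrix_mul_shiftMatrix_mul_conjTranspose (hG : G.IsRegularOfDegree k) :
    G.boundaryMatrix * (G.shiftMatrix * G.boundaryMatrixᴴ) = (k : ℂ)⁻¹ • G.adjMatrix ℂ := by
  ext u v
  have hk' : ((Real.sqrt k : ℝ) : ℂ) * ((Real.sqrt k : ℝ) : ℂ) = k := by
    rw [← Complex.ofReal_mul, Real.mul_self_sqrt (by positivity)]; simp
  rw [Matrix.mul_apply]
  simp only [shiftMatrix_mul_apply, boundaryMatrix, Matrix.conjTranspose_apply, Matrix.of_apply,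
    hG.degree_eq, Matrix.smul_apply, adjMatrix_apply]
  by_cases h : G.Adj u v
  · rw [Finset.sum_eq_single (⟨(v, u), h.symm⟩ : G.Dart)]
    · simp [h, ← hk']
    · intro d _ hd
      by_cases h1 : u = d.snd
      · by_cases h2 : v = d.fst
        · exact absurd (Dart.ext _ _ (Prod.ext h2.symm h1.symm)) hd
        · simp [Dart.symm, h2]
      · simp [h1]
    · simp
  · simp only [h, if_false, smul_zero]
    refine Finset.sum_eq_zero fun d _ => ?_
    by_cases h1 : u = d.snd
    · by_cases h2 : v = d.fst
      · exact absurd (by rw [h1, h2]; exact d.adj.symm) h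
      · simp [Dart.symm, h2]
    · simp [h1]

/-- `N N* = 1` makes `K` the identity on the range of `N*`. -/
theorem groverMatrix_mul_conjTranspose_boundaryMatrix (hk : 0 < k) (hG : G.IsRegularOfDegree k) :
    G.groverMatrix * G.boundaryMatrixᴴ = G.shiftMatrix * G.boundaryMatrixᴴ := by
  rw [groverMatrix, coinMatrix, Matrix.mul_assoc, Matrix.sub_mul, Matrix.smul_mul,
    Matrix.mul_assoc,
    boundaryMatrix_mul_conjTranspose hk hG]
  simp [two_smul]

/-- This is the Chebyshev recurrence: `U S N* = S (2 N* N - 1) S N*`, where `N S N* = P` and `S² =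
1`. -/
theorem groverMatrix_sq_mul_conjTranspose_boundaryMatrix (hk : 0 < k)
    (hG : G.IsRegularOfDegree k) :
    G.groverMatrix * (G.groverMatrix * G.boundaryMatrixᴴ) =
      (2 : ℂ) • (G.groverMatrix * G.boundaryMatrixᴴ * ((k : ℂ)⁻¹ • G.adjMatrix ℂ))
        - G.boundaryMatrixᴴ := by
  rw [groverMatrix_mul_conjTranspose_boundaryMatrix hk hG,
    ← boundaryMatrix_mul_shiftMatrix_mul_conjTranspose hG, groverMatrix, coinMatrix,
    Matrix.mul_assoc, Matrix.sub_mul, Matrix.smul_mul, Matrix.one_mul, Matrix.mul_sub,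
    ← Matrix.mul_assoc G.shiftMatrix G.shiftMatrix, shiftMatrix_mul_self, Matrix.one_mul,
    Matrix.mul_smul]
  simp only [Matrix.mul_assoc]

/-- Compressing the powers of the Grover matrix gives the Chebyshev polynomials of the
normalized adjacency matrix. -/
theorem boundaryMatrix_mul_groverMatrix_pow_mul (hk : 0 < k) (hG : G.IsRegularOfDegree k)
    (n : ℕ) :
    G.boundaryMatrix * (G.groverMatrix ^ n * G.boundaryMatrixᴴ) =
      aeval ((k : ℂ)⁻¹ • G.adjMatrix ℂ) (Chebyshev.T ℂ n) := by
  induction n using Nat.twoStepInduction with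
  | zero => simp [boundaryMatrix_mul_conjTranspose hk hG]
  | one =>
    simp [groverMatrix_mul_conjTranspose_boundaryMatrix hk hG,
      boundaryMatrix_mul_shiftMatrix_mul_conjTranspose hG]
  | more n ih1 ih2 =>
    have h : (Chebyshev.T ℂ ((n + 2 : ℕ) : ℤ))
        = 2 * X * Chebyshev.T ℂ ((n + 1 : ℕ) : ℤ) - Chebyshev.T ℂ n := by
      push_cast
      exact Chebyshev.T_add_two ℂ n
    rw [h, mul_comm (2 * X), ← mul_assoc, mul_comm _ (2 : ℂ[X]), map_sub, map_mul, map_mul,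
      ← ih1, ← ih2, aeval_X, map_ofNat, pow_add, pow_two, Matrix.mul_assoc, Matrix.mul_assoc,
      groverMatrix_sq_mul_conjTranspose_boundaryMatrix hk hG, pow_succ]
    simp only [Matrix.mul_sub, Matrix.mul_smul, Matrix.mul_assoc, two_mul, two_smul,
      Matrix.add_mul, Matrix.mul_add, smul_add]

theorem aeval_T_mulVec_of_perfectStateTransfer (hk : 0 < k) (hG : G.IsRegularOfDegree k)
    {u v : V} {n : ℕ} {γ : ℂ}
    (h : (G.groverMatrix ^ n) *ᵥ G.vertexState u = γ • G.vertexState v) :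
    aeval ((k : ℂ)⁻¹ • G.adjMatrix ℂ) (Chebyshev.T ℂ n) *ᵥ Pi.single u 1
      = γ • Pi.single v (1 : ℂ) := by
  rw [← boundaryMatrix_mul_groverMatrix_pow_mul hk hG, ← Matrix.mulVec_mulVec,
    ← Matrix.mulVec_mulVec]
  change G.boundaryMatrix *ᵥ (G.groverMatrix ^ n *ᵥ G.vertexState u) = _
  rw [h, Matrix.mulVec_smul, vertexState, Matrix.mulVec_mulVec,
    boundaryMatrix_mul_conjTranspose hk hG, Matrix.one_mulVec]

/-- `S` is a Hermitian involution and `K` is the reflection attached to the projection `N* N`. -/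
theorem conjTranspose_mul_groverMatrix (hk : 0 < k) (hG : G.IsRegularOfDegree k) :
    G.groverMatrixᴴ * G.groverMatrix = 1 := by
  have hN := boundaryMatrix_mul_conjTranspose hk hG
  have hP : (G.boundaryMatrixᴴ * G.boundaryMatrix) * (G.boundaryMatrixᴴ * G.boundaryMatrix)
      = G.boundaryMatrixᴴ * G.boundaryMatrix := by
    rw [Matrix.mul_assoc, ← Matrix.mul_assoc G.boundaryMatrix, hN, Matrix.one_mul]
  have hK : G.coinMatrixᴴ = G.coinMatrix := by
    simp [coinMatrix, Matrix.conjTranspose_mul]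
  rw [groverMatrix, Matrix.conjTranspose_mul, conjTranspose_shiftMatrix, hK, Matrix.mul_assoc,
    ← Matrix.mul_assoc G.shiftMatrix, shiftMatrix_mul_self, Matrix.one_mul, coinMatrix]
  simp only [sub_mul, mul_sub, two_smul, add_mul, mul_add, hP, one_mul, mul_one]
  abel

theorem conjTranspose_mul_groverMatrix_pow (hk : 0 < k) (hG : G.IsRegularOfDegree k) (n : ℕ) :
    (G.groverMatrix ^ n)ᴴ * G.groverMatrix ^ n = 1 := by
  induction n with
  | zero => simp
  | succ n ih =>
    rw [pow_succ, Matrix.conjTranspose_mul, Matrix.mul_assoc,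
      ← Matrix.mul_assoc (G.groverMatrix ^ n)ᴴ, ih, Matrix.one_mul,
      conjTranspose_mul_groverMatrix hk hG]

-- The hypothesis only controls the projection `N w` of `w = U^n Φ_u`. But `w` and `Φ_v` are unit
-- vectors with inner product `1`, so `‖w - Φ_v‖² = 0`.
open scoped ComplexOrder in
theorem perfectStateTransferAt_of_aeval_T_mulVec (hk : 0 < k) (hG : G.IsRegularOfDegree k)
    {u v : V} (huv : u ≠ v) {n : ℕ} (hn : 0 < n)
    (h : aeval ((k : ℂ)⁻¹ • G.adjMatrix ℂ) (Chebyshev.T ℂ n) *ᵥ Pi.single u 1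
      = Pi.single v (1 : ℂ)) :
    G.PerfectStateTransferAt u v n := by
  refine ⟨huv, hn, 1, by simp, ?_⟩
  have hN := boundaryMatrix_mul_conjTranspose hk hG
  set w := G.groverMatrix ^ n *ᵥ G.vertexState u with hw
  have hNw : G.boundaryMatrix *ᵥ w = Pi.single v 1 := by
    rw [← h, ← boundaryMatrix_mul_groverMatrix_pow_mul hk hG, ← Matrix.mulVec_mulVec,
      ← Matrix.mulVec_mulVec, hw, vertexState]
  have hΦ (y : V) : star (G.vertexState y) = star (Pi.single y 1) ᵥ* G.boundaryMatrix := by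
    rw [vertexState, Matrix.star_mulVec, Matrix.conjTranspose_conjTranspose]
  have hΦΦ (y : V) : star (G.vertexState y) ⬝ᵥ G.vertexState y = 1 := by
    rw [hΦ, ← Matrix.dotProduct_mulVec, vertexState, Matrix.mulVec_mulVec, hN, Matrix.one_mulVec]
    simp
  have hww : star w ⬝ᵥ w = 1 := by
    rw [hw, Matrix.star_mulVec, ← Matrix.dotProduct_mulVec, Matrix.mulVec_mulVec,
      conjTranspose_mul_groverMatrix_pow hk hG, Matrix.one_mulVec, hΦΦ]
  have hΦw : star (G.vertexState v) ⬝ᵥ w = 1 := by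
    rw [hΦ, ← Matrix.dotProduct_mulVec, hNw]
    simp
  have hwΦ : star w ⬝ᵥ G.vertexState v = 1 := by
    rw [← star_star (G.vertexState v), Matrix.star_dotProduct_star, hΦw, star_one]
  have : star (w - G.vertexState v) ⬝ᵥ (w - G.vertexState v) = 0 := by
    rw [star_sub, sub_dotProduct, dotProduct_sub, dotProduct_sub, hww, hΦw, hwΦ, hΦΦ]
    ring
  rw [one_smul]
  exact sub_eq_zero.1 (dotProduct_star_self_eq_zero.1 this)

end GroverWalk

/-! ### Distance-regular graphs and their matrix algebra -/

section DistanceRegular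

variable {V : Type*} [Fintype V] {G : SimpleGraph V}

theorem IsDistanceRegular.card_dist_eq (hG : G.IsDistanceRegular) (i : ℕ) (u v : V) :
    (Finset.univ.filter fun w => G.dist u w = i).card
      = (Finset.univ.filter fun w => G.dist v w = i).card := by
  simpa using hG.2 i i u u v v (by simp)

theorem IsDistanceRegular.exists_isRegularOfDegree [DecidableRel G.Adj]
    (hG : G.IsDistanceRegular) : ∃ k, G.IsRegularOfDegree k := by
  obtain ⟨u⟩ := hG.1.nonempty
  have (v : V) : G.degree v = (Finset.univ.filter fun w => G.dist v w = 1).card := by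
    rw [← card_neighborFinset_eq_degree]
    congr 1
    ext w
    simp [dist_eq_one_iff_adj]
  exact ⟨G.degree u, fun v => by rw [this, this]; exact hG.card_dist_eq 1 v u⟩

theorem IsDistanceRegular.sum_dist_eq (hG : G.IsDistanceRegular) (F : ℕ × ℕ → ℂ) {u v u' v' : V}
    (h : G.dist u v = G.dist u' v') :
    ∑ w, F (G.dist u w, G.dist v w) = ∑ w, F (G.dist u' w, G.dist v' w) := by
  have key : (Finset.univ.val.map fun w => (G.dist u w, G.dist v w))
      = Finset.univ.val.map fun w => (G.dist u' w, G.dist v' w) := by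
    ext ⟨i, j⟩
    have := hG.2 i j u v u' v' h
    rw [Multiset.count_map, Multiset.count_map]
    simp only [Finset.card_def, Finset.filter_val] at this
    simpa only [Prod.mk.injEq, eq_comm] using this
  have := congrArg (fun s : Multiset (ℕ × ℕ) => (s.map F).sum) key
  simpa [Multiset.map_map] using this

variable [DecidableEq V]

/-- The Bose-Mesner algebra of a distance-regular graph: the matrices whose entries depend only on
the distance of the two indices. -/
def IsDistanceRegular.distanceAlgebra (hG : G.IsDistanceRegular) :
    Subalgebra ℂ (Matrix V V ℂ) where
  carrier := {M | ∃ f : ℕ → ℂ, ∀ x y, M x y = f (G.dist x y)}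
  mul_mem' := by
    rintro M M' ⟨f, hf⟩ ⟨g, hg⟩
    have key (x y x' y' : V) (h : G.dist x y = G.dist x' y') : (M * M') x y = (M * M') x' y' := by
      have := hG.sum_dist_eq (fun p => f p.1 * g p.2) h
      simpa [Matrix.mul_apply, hf, hg, dist_comm] using this
    classical
    -- The entry is read off at any pair at distance `i`; the value `0` at unattained distances is
    -- arbitrary.
    refine ⟨fun i => if h : ∃ p : V × V, G.dist p.1 p.2 = i then
      (M * M') h.choose.1 h.choose.2 else 0, fun x y => ?_⟩
    have h : ∃ p : V × V, G.dist p.1 p.2 = G.dist x y := ⟨(x, y), rfl⟩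
    beta_reduce
    rw [dif_pos h]
    exact key _ _ _ _ h.choose_spec.symm
  add_mem' := by
    rintro M M' ⟨f, hf⟩ ⟨g, hg⟩
    exact ⟨fun i => f i + g i, fun x y => by simp [hf, hg]⟩
  algebraMap_mem' := by
    intro c
    refine ⟨fun i => if i = 0 then c else 0, fun x y => ?_⟩
    simp [Matrix.algebraMap_matrix_apply, hG.1.dist_eq_zero_iff]

theorem IsDistanceRegular.aeval_mem_distanceAlgebra [DecidableRel G.Adj]
    (hG : G.IsDistanceRegular) (c : ℂ) (p : ℂ[X]) :
    aeval (c • G.adjMatrix ℂ) p ∈ hG.distanceAlgebra := by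
  have hA : G.adjMatrix ℂ ∈ hG.distanceAlgebra :=
    ⟨fun i => if i = 1 then 1 else 0, fun x y => by simp [adjMatrix_apply, dist_eq_one_iff_adj]⟩
  exact Algebra.adjoin_le (Set.singleton_subset_iff.2 (Subalgebra.smul_mem _ hA c))
    (aeval_mem_adjoin_singleton ℂ _)

omit [DecidableEq V] in
theorem IsRegularOfDegree.smul_adjMatrix_mulVec_one [DecidableRel G.Adj] {k : ℕ}
    (hG : G.IsRegularOfDegree k) (hk : 0 < k) :
    ((k : ℂ)⁻¹ • G.adjMatrix ℂ) *ᵥ (fun _ => 1) = (1 : ℂ) • fun _ => 1 := by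
  have hk0 : (k : ℂ) ≠ 0 := by exact_mod_cast hk.ne'
  ext x
  simp [Matrix.smul_mulVec, adjMatrix_mulVec_apply, hG.degree_eq, hk0]

/-- If a polynomial with value `1` at `1`, applied to the normalized adjacency matrix of a
distance-regular graph, maps a standard basis vector to a multiple of another one, then it is the
permutation matrix of a fixed-point-free involution that moves all vertices to the only vertex at
a certain distance. -/
theorem IsDistanceRegular.exists_involutive [DecidableRel G.Adj] (hG : G.IsDistanceRegular)
    {k : ℕ} (hk : 0 < k) (hreg : G.IsRegularOfDegree k) {u v : V} (huv : u ≠ v) {γ : ℂ}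
    (hγ : ‖γ‖ = 1) {p : ℂ[X]} (hp : p.eval 1 = 1)
    (h : aeval ((k : ℂ)⁻¹ • G.adjMatrix ℂ) p *ᵥ Pi.single u 1 = γ • Pi.single v (1 : ℂ)) :
    ∃ (q : V → V) (i : ℕ), Function.Involutive q ∧ (∀ x, q x ≠ x) ∧
      (∀ x y, G.dist x y = i ↔ y = q x) ∧
      aeval ((k : ℂ)⁻¹ • G.adjMatrix ℂ) p = Matrix.of fun x y => if y = q x then 1 else 0 := by
  obtain ⟨f, hf⟩ := hG.aeval_mem_distanceAlgebra (k : ℂ)⁻¹ p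
  have hM1 := Matrix.aeval_mulVec_of_mulVec_eq_smul (hreg.smul_adjMatrix_mulVec_one hk) p
  set M := aeval ((k : ℂ)⁻¹ • G.adjMatrix ℂ) p
  have hγ0 : γ ≠ 0 := by rintro rfl; simp at hγ
  have hcol (x : V) : f (G.dist x u) = if x = v then γ else 0 := by
    rw [← hf]
    have := congrFun h x
    simpa [Pi.single_apply] using this
  set i := G.dist v u with hi
  have hfi : f i = γ := by rw [hcol, if_pos rfl]
  -- `f i = γ` is nonzero, so any vertex at distance `i` from `u` gives a nonzero entry in column
  -- `u`, and only `v` does.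
  have hiff (w : V) : G.dist u w = i ↔ w = v := by
    refine ⟨fun hw => ?_, fun hw => by rw [hw, hi, dist_comm]⟩
    by_contra hne
    have := hcol w
    rw [dist_comm, hw, hfi, if_neg hne] at this
    exact hγ0 this
  have hcard (x : V) : (Finset.univ.filter fun w => G.dist x w = i).card = 1 := by
    rw [hG.card_dist_eq i x u]
    simp [hiff, Finset.filter_eq']
  have hq (x : V) : ∃ y, ∀ w, G.dist x w = i ↔ w = y := by
    obtain ⟨y, hy⟩ := Finset.card_eq_one.1 (hcard x)
    refine ⟨y, fun w => ?_⟩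
    have : w ∈ (Finset.univ.filter fun w => G.dist x w = i) ↔ w ∈ ({y} : Finset V) := by rw [hy]
    simpa using this
  choose q hq using hq
  have hMγ (x y : V) : M x y = if y = q x then γ else 0 := by
    by_cases hxy : y = q x
    · rw [if_pos hxy, hf, (hq x y).2 hxy, hfi]
    · rw [if_neg hxy, hf]
      -- Every distance occurring from `x` also occurs from `u`, so column `u` determines all
      -- relevant values of `f`.
      have hpos : 0 < (Finset.univ.filter fun w => G.dist x w = G.dist x y).card :=
        Finset.card_pos.2 ⟨y, by simp⟩
      rw [hG.card_dist_eq _ x u] at hpos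
      obtain ⟨w, hw⟩ := Finset.card_pos.1 hpos
      replace hw : G.dist u w = G.dist x y := by simpa using hw
      rw [← hw, dist_comm, hcol, if_neg]
      rintro rfl
      exact hxy ((hq x y).1 (hw.symm.trans ((hiff _).2 rfl)))
  have hγ1 : γ = 1 := by
    have := congrFun hM1 u
    rw [hp, one_smul] at this
    simpa [Matrix.mulVec, dotProduct, hMγ] using this
  refine ⟨q, i, fun x => ?_, fun x hx => ?_, hq, ?_⟩
  · exact ((hq _ _).1 (by rw [dist_comm]; exact (hq x _).2 rfl)).symm
  · have h0 := (hq x x).2 hx.symm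
    rw [dist_self] at h0
    exact huv ((hG.1.dist_eq_zero_iff.1 (hi.symm.trans h0.symm))).symm
  · ext x y
    rw [hMγ, hγ1, Matrix.of_apply]

theorem IsIntegralGraph.exists_rat_eq_of_mulVec [DecidableRel G.Adj] (hG : G.IsIntegralGraph)
    {k : ℕ} (hk : 0 < k) {μ : ℂ} {x : V → ℂ} (hx : x ≠ 0)
    (h : ((k : ℂ)⁻¹ • G.adjMatrix ℂ) *ᵥ x = μ • x) : ∃ q : ℚ, μ = q := by
  have hk0 : (k : ℂ) ≠ 0 := by exact_mod_cast hk.ne'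
  have h' : G.adjMatrix ℂ *ᵥ x = (k * μ) • x := by
    rw [mul_smul, ← h, Matrix.smul_mulVec, smul_smul, mul_inv_cancel₀ hk0, one_smul]
  obtain ⟨m, hm⟩ := hG (k * μ) (Module.End.hasEigenvalue_of_hasEigenvector (x := x)
    ⟨Module.End.mem_eigenspace_iff.2 (by rw [Matrix.toLin'_apply, h']), hx⟩)
  refine ⟨m / k, ?_⟩
  push_cast
  rw [← hm]
  field_simp

omit [Fintype V] [DecidableEq V] in
theorem isHermitian_smul_adjMatrix [DecidableRel G.Adj] (k : ℕ) :
    ((k : ℂ)⁻¹ • G.adjMatrix ℂ).IsHermitian := by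
  ext x y
  by_cases h : G.Adj x y
  · simp [Matrix.conjTranspose_apply, h, h.symm]
  · have h' : ¬G.Adj y x := fun h' => h h'.symm
    simp [Matrix.conjTranspose_apply, h, h']

theorem eval_sq_eq_one_of_aeval_sq_eq_one {M : Matrix V V ℂ} {p : ℂ[X]}
    (hM : aeval M p * aeval M p = 1) {μ : ℂ} {x : V → ℂ} (hx : x ≠ 0) (h : M *ᵥ x = μ • x) :
    p.eval μ ^ 2 = 1 := by
  have h1 := Matrix.aeval_mulVec_of_mulVec_eq_smul h (p ^ 2)
  rw [pow_two, map_mul, hM, Matrix.one_mulVec, ← pow_two, eval_pow] at h1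
  obtain ⟨i, hi⟩ := Function.ne_iff.1 hx
  have := congrFun h1 i
  exact mul_right_cancel₀ hi (by simpa using this.symm)

theorem involutionMatrix_mul_self {q : V → V} (hq : Function.Involutive q) :
    (Matrix.of fun x y => if y = q x then (1 : ℂ) else 0) *
      (Matrix.of fun x y => if y = q x then (1 : ℂ) else 0) = 1 := by
  ext x y
  rw [Matrix.mul_apply, Finset.sum_eq_single (q x)]
  · simp [Matrix.one_apply, hq x, eq_comm]
  · intro z _ hz
    simp [hz]
  · simp

end DistanceRegular

/-! ### Recognizing a regular graph from an injective homomorphism -/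

section Iso

variable {V W : Type*} [Fintype V] [Fintype W] [Nonempty W] {G : SimpleGraph V}
  {H : SimpleGraph W} [DecidableRel G.Adj] [DecidableRel H.Adj]

/-- An injective homomorphism to a connected regular graph from a graph with the same valency is
an isomorphism. -/
theorem Connected.nonempty_iso_of_injective_hom {k : ℕ} (hc : G.Connected)
    (hG : G.IsRegularOfDegree k) (hH : H.IsRegularOfDegree k) (f : W → V)
    (hf : Function.Injective f) (hom : ∀ x y, H.Adj x y → G.Adj (f x) (f y)) :
    Nonempty (G ≃g H) := by
  classical
  -- Equal valencies make `f` a bijection on neighbourhoods. So its range is closed under adjacency,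
  -- and adjacency is reflected.
  have himg (x : W) : (H.neighborFinset x).image f = G.neighborFinset (f x) := by
    refine Finset.eq_of_subset_of_card_le (fun z hz => ?_) ?_
    · obtain ⟨y, hy, rfl⟩ := Finset.mem_image.1 hz
      simpa using hom x y (by simpa using hy)
    · rw [Finset.card_image_of_injective _ hf, card_neighborFinset_eq_degree,
        card_neighborFinset_eq_degree, hG.degree_eq, hH.degree_eq]
  have hlift {x : W} {z : V} (h : G.Adj (f x) z) : ∃ y, H.Adj x y ∧ f y = z := by
    have : z ∈ (H.neighborFinset x).image f := by rw [himg]; simpa using h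
    obtain ⟨y, hy, rfl⟩ := Finset.mem_image.1 this
    exact ⟨y, by simpa using hy, rfl⟩
  have hsurj : Function.Surjective f := by
    obtain ⟨x₀⟩ := ‹Nonempty W›
    have key {a b : V} (w : G.Walk a b) : (∃ x, f x = a) → ∃ x, f x = b := by
      induction w with
      | nil => exact id
      | cons h _ ih =>
        rintro ⟨x, rfl⟩
        obtain ⟨y, -, hy⟩ := hlift h
        exact ih ⟨y, hy⟩
    intro z
    obtain ⟨w⟩ := hc.preconnected (f x₀) z
    exact key w ⟨x₀, rfl⟩
  refine ⟨(RelIso.mk (Equiv.ofBijective f ⟨hf, hsurj⟩) ?_ : H ≃g G).symm⟩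
  intro x y
  refine ⟨fun h => ?_, hom x y⟩
  obtain ⟨y', hy', he⟩ := hlift h
  rwa [← hf he]

end Iso

/-! ### Cocktail party graphs, `K_2` and the hexagon -/

section Classification

theorem isRegularOfDegree_completeGraph_two :
    (completeGraph (Fin 2)).IsRegularOfDegree 1 := by
  intro v
  fin_cases v <;> decide

theorem isRegularOfDegree_cycleGraph_four : (cycleGraph 4).IsRegularOfDegree 2 :=
  fun _ => cycleGraph_degree_three_le

theorem isRegularOfDegree_cycleGraph_six : (cycleGraph 6).IsRegularOfDegree 2 :=
  fun _ => cycleGraph_degree_three_le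

theorem isRegularOfDegree_completeMultipartiteGraph_three_two :
    (completeMultipartiteGraph (fun _ : Fin 3 => Fin 2)).IsRegularOfDegree 4 := by
  rintro ⟨i, j⟩
  fin_cases i <;> fin_cases j <;> decide

variable {V : Type*} [Fintype V] [DecidableEq V] {G : SimpleGraph V} [DecidableRel G.Adj]
  {k : ℕ} {q : V → V}

omit [DecidableEq V] in
theorem IsRegularOfDegree.exists_adj_ne {s : Finset V} (hreg : G.IsRegularOfDegree k)
    (hs : s.card < k) (x : V) : ∃ y, G.Adj x y ∧ y ∉ s := by
  have : s.card < (G.neighborFinset x).card := by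
    rwa [card_neighborFinset_eq_degree, hreg.degree_eq]
  obtain ⟨y, hy, hys⟩ := Finset.exists_mem_notMem_of_card_lt_card this
  exact ⟨y, by simpa using hy, hys⟩

/-- A connected graph in which any vertex `x` and `q x` have the same neighbours, and `q x` is the
only vertex at its distance from `x`, is a cocktail party graph. -/
theorem Connected.adj_iff_of_twins (hc : G.Connected) (hk : 0 < k) (hreg : G.IsRegularOfDegree k)
    (hqne : ∀ x, q x ≠ x) {i : ℕ}
    (hdist : ∀ x y, G.dist x y = i ↔ y = q x) (htwin : ∀ x y, G.Adj x (q y) ↔ G.Adj x y)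
    (x y : V) : G.Adj x y ↔ y ≠ x ∧ y ≠ q x := by
  have hnot (x : V) : ¬G.Adj x (q x) := by rw [htwin]; exact G.irrefl
  have dist_two {a b c : V} (hab : G.Adj a b) (hbc : G.Adj b c) (hac : ¬G.Adj a c)
      (hne : a ≠ c) : G.dist a c = 2 := by
    have h2 : G.dist a c ≤ 2 := dist_le (Walk.cons hab (Walk.cons hbc Walk.nil))
    have h1 : G.dist a c ≠ 1 := fun h => hac (dist_eq_one_iff_adj.1 h)
    have h0 : G.dist a c ≠ 0 := fun h => hne (hc.dist_eq_zero_iff.1 h)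
    omega
  have hi : i = 2 := by
    obtain ⟨y, hy, -⟩ := hreg.exists_adj_ne (s := ∅) (by simpa using hk) x
    rw [← (hdist x (q x)).2 rfl]
    exact dist_two hy ((htwin y x).2 hy.symm) (hnot x) (hqne x).symm
  subst hi
  refine ⟨fun h => ⟨h.ne', fun h' => hnot x (h' ▸ h)⟩, fun ⟨h1, h2⟩ => ?_⟩
  -- The set consisting of `x`, `q x` and the neighbours of `x` is closed under adjacency, hence is
  -- everything.
  have key {a b : V} (w : G.Walk a b) : (a = x ∨ a = q x ∨ G.Adj x a) →
      (b = x ∨ b = q x ∨ G.Adj x b) := by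
    induction w with
    | nil => exact id
    | @cons a c _ h _ ih =>
      intro ha
      refine ih ?_
      rcases ha with rfl | rfl | ha
      · exact Or.inr (Or.inr h)
      · exact Or.inr (Or.inr (((htwin c x).1 h.symm).symm))
      · by_cases h1 : x = c
        · exact Or.inl h1.symm
        · by_cases h2 : G.Adj x c
          · exact Or.inr (Or.inr h2)
          · exact Or.inr (Or.inl ((hdist x c).1 (dist_two ha h h2 h1)))
  obtain ⟨w⟩ := hc.preconnected x y
  rcases key w (Or.inl rfl) with h | h | h
  · exact absurd h h1
  · exact absurd h h2
  · exact h

/-- Cocktail party graphs have the eigenvalue `-2`. -/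
theorem exists_eigenvector_of_cocktailParty (hk : 0 < k) (hreg : G.IsRegularOfDegree k)
    (hq : Function.Involutive q) (hqne : ∀ x, q x ≠ x)
    (hadj : ∀ x y, G.Adj x y ↔ y ≠ x ∧ y ≠ q x) (u : V) :
    ∃ z : V → ℂ, z ≠ 0 ∧ ((k : ℂ)⁻¹ • G.adjMatrix ℂ) *ᵥ z = (-2 / k : ℂ) • z := by
  obtain ⟨w, hw, -⟩ := hreg.exists_adj_ne (s := ∅) (by simpa using hk) u
  have hA (x a : V) : G.adjMatrix ℂ x a
      = 1 - (if x = a then 1 else 0) - (if x = q a then 1 else 0) := by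
    rw [adjMatrix_apply]
    by_cases h1 : x = a
    · subst h1
      simp [(hqne x).symm]
    · by_cases h2 : x = q a
      · have : ¬G.Adj x a := by rw [hadj, h2, hq a]; simp
        rw [if_neg this, if_neg h1, if_pos h2]
        ring
      · have : G.Adj x a := by
          rw [hadj]
          exact ⟨Ne.symm h1, fun h => h2 (by rw [h, hq])⟩
        simp [this, h1, h2]
  -- With `A = J - I - Q`, `J` the all-ones matrix and `Q` the matrix of `q`, this vector is killed
  -- by `J` and fixed by `Q`.
  refine ⟨Pi.single u 1 + Pi.single (q u) 1 - Pi.single w 1 - Pi.single (q w) 1, fun h => ?_, ?_⟩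
  · have := congrFun h u
    have h1 : u ≠ q w := fun h => ((hadj w u).1 hw.symm).2 h
    simp [hw.ne, h1, (hqne u).symm] at this
  · ext x
    simp only [Matrix.mulVec_sub, Matrix.mulVec_add, Matrix.mulVec_single_one,
      Pi.smul_apply, Pi.sub_apply, Pi.add_apply, Matrix.col_apply, Matrix.smul_apply, hA, smul_eq_mul,
      Pi.single_apply, hq u, hq w]
    ring

theorem Connected.nonempty_iso_of_cocktailParty (hc : G.Connected) (hk : k = 2 ∨ k = 4)
    (hreg : G.IsRegularOfDegree k) (hq : Function.Involutive q) (hqne : ∀ x, q x ≠ x)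
    (hadj : ∀ x y, G.Adj x y ↔ y ≠ x ∧ y ≠ q x) (u : V) :
    Nonempty (G ≃g cycleGraph 4) ∨
      Nonempty (G ≃g completeMultipartiteGraph (fun _ : Fin 3 => Fin 2)) := by
  have htwin (x y : V) : G.Adj x (q y) ↔ G.Adj x y := by
    rw [hadj, hadj, hq.injective.ne_iff, and_comm]
    refine and_congr_right' ?_
    rw [not_iff_not]
    exact ⟨fun h => by rw [← h, hq], fun h => by rw [h, hq]⟩
  have htwin' (x y : V) : G.Adj (q x) y ↔ G.Adj x y := by
    rw [adj_comm, htwin, adj_comm]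
  rcases hk with rfl | rfl
  · left
    obtain ⟨w, hw, -⟩ := hreg.exists_adj_ne (s := ∅) (by simp) u
    have h1 : u ≠ q w := fun h => ((hadj w u).1 hw.symm).2 h
    have h2 : q u ≠ w := fun h => ((hadj u w).1 hw).2 h.symm
    refine hc.nonempty_iso_of_injective_hom hreg isRegularOfDegree_cycleGraph_four
      ![u, w, q u, q w] ?_ ?_
    · intro a b
      fin_cases a <;> fin_cases b <;>
        simp [hw.ne, hw.ne', h1, h1.symm, h2, h2.symm, hqne, (hqne _).symm, hq.injective.eq_iff]
    · intro a b
      fin_cases a <;> fin_cases b <;>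
        simp [cycleGraph_adj, htwin, htwin', hw, hw.symm] <;> decide
  · right
    obtain ⟨w, hw, -⟩ := hreg.exists_adj_ne (s := ∅) (by simp) u
    obtain ⟨y, hy, hyw⟩ := hreg.exists_adj_ne (s := {w, q w})
      (lt_of_le_of_lt Finset.card_le_two (by norm_num)) u
    have hwy : G.Adj w y := (hadj w y).2 (by simpa using hyw)
    have hr (a b : Fin 3) (hab : a ≠ b) : G.Adj (![u, w, y] a) (![u, w, y] b) := by
      fin_cases a <;> fin_cases b <;> simp_all [adj_comm]
    set r : Fin 3 → V := ![u, w, y]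
    have hom (a b : Σ _ : Fin 3, Fin 2) (hab : a.1 ≠ b.1) :
        G.Adj (if a.2 = 0 then r a.1 else q (r a.1)) (if b.2 = 0 then r b.1 else q (r b.1)) := by
      have := hr _ _ hab
      split_ifs <;> simpa only [htwin, htwin'] using this
    refine hc.nonempty_iso_of_injective_hom hreg
      isRegularOfDegree_completeMultipartiteGraph_three_two
      (fun a => if a.2 = 0 then r a.1 else q (r a.1)) ?_ fun a b hab => hom a b hab
    intro a b hab
    by_cases h : a.1 = b.1
    · obtain ⟨a, i⟩ := a
      obtain ⟨b, j⟩ := b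
      obtain rfl : a = b := h
      have : i = j := by
        fin_cases i <;> fin_cases j <;> simp_all [eq_comm]
      rw [this]
    · exact absurd hab (hom a b h).ne

omit [DecidableEq V] in
theorem Connected.nonempty_iso_completeGraph_two (hc : G.Connected)
    (hreg : G.IsRegularOfDegree 1) (u : V) : Nonempty (G ≃g completeGraph (Fin 2)) := by
  obtain ⟨w, hw, -⟩ := hreg.exists_adj_ne (s := ∅) (by simp) u
  refine hc.nonempty_iso_of_injective_hom hreg isRegularOfDegree_completeGraph_two ![u, w] ?_ ?_
  · intro a b
    fin_cases a <;> fin_cases b <;> simp [hw.ne, hw.ne']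
  · intro a b
    fin_cases a <;> fin_cases b <;> simp [hw, hw.symm]

omit [DecidableEq V] in
theorem sq_adjMatrix_apply (x y : V) : (G.adjMatrix ℂ * G.adjMatrix ℂ) x y
    = (Finset.univ.filter fun z => G.Adj x z ∧ G.Adj z y).card := by
  rw [adjMatrix_mul_apply, Finset.card_filter, Nat.cast_sum]
  simp only [adjMatrix_apply]
  rw [neighborFinset_eq_filter, Finset.sum_filter]
  refine Finset.sum_congr rfl fun z _ => ?_
  by_cases h : G.Adj x z <;> simp [h]

/-- A connected graph of valency two in which the vertices `y ≠ x` at the end of a walk of length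
two from `x` are exactly the neighbours of `q x` is a hexagon. -/
theorem Connected.nonempty_iso_cycleGraph_six (hc : G.Connected) (hreg : G.IsRegularOfDegree 2)
    (hqne : ∀ x, q x ≠ x) (hnot : ∀ x, ¬G.Adj x (q x))
    (h2 : ∀ x y, x ≠ y → (Finset.univ.filter fun z => G.Adj x z ∧ G.Adj z y).card
      = if G.Adj (q x) y then 1 else 0) (u : V) :
    Nonempty (G ≃g cycleGraph 6) := by
  have two {x y z : V} (hxy : x ≠ y) (h1 : G.Adj x z) (h3 : G.Adj z y) :
      G.Adj (q x) y ∧ ∀ z', G.Adj x z' → G.Adj z' y → z' = z := by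
    have h := h2 x y hxy
    have hz : z ∈ Finset.univ.filter fun z => G.Adj x z ∧ G.Adj z y := by simp [h1, h3]
    have hpos := Finset.card_pos.2 ⟨z, hz⟩
    have hq : G.Adj (q x) y := by
      by_contra hq
      rw [if_neg hq] at h
      omega
    refine ⟨hq, fun z' h1' h3' => ?_⟩
    rw [if_pos hq] at h
    exact Finset.card_le_one.1 h.le z' (by simp [h1', h3']) z hz
  have three {x a b c : V} (ha : G.Adj x a) (hb : G.Adj x b) (hc : G.Adj x c) (hab : a ≠ b)
      (hac : a ≠ c) (hbc : b ≠ c) : False := by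
    have : ({a, b, c} : Finset V).card ≤ (G.neighborFinset x).card := by
      refine Finset.card_le_card fun z hz => ?_
      simp only [Finset.mem_insert, Finset.mem_singleton] at hz
      rcases hz with rfl | rfl | rfl <;> simpa
    rw [card_neighborFinset_eq_degree, hreg.degree_eq, Finset.card_eq_three.2
      ⟨a, b, c, hab, hac, hbc, rfl⟩] at this
    omega
  obtain ⟨a, ha, -⟩ := hreg.exists_adj_ne (s := ∅) (by simp) u
  obtain ⟨b, hb, hba⟩ := hreg.exists_adj_ne (s := {a}) (by simp) u
  obtain ⟨a', ha', hau⟩ := hreg.exists_adj_ne (s := {u}) (by simp) a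
  obtain ⟨b', hb', hbu⟩ := hreg.exists_adj_ne (s := {u}) (by simp) b
  rw [Finset.mem_singleton] at hba hau hbu
  -- Both walks of length two from `u` end at neighbours of `q u`, which closes the hexagon `u, a,
  -- a', q u, b', b`.
  obtain ⟨hqa, hua⟩ := two (Ne.symm hau) ha ha'
  obtain ⟨hqb, -⟩ := two (Ne.symm hbu) hb hb'
  have hab' : a' ≠ b' := fun h => hba (hua b hb (h ▸ hb'))
  have hqua : q u ≠ a := fun h => hnot u (h ▸ ha)
  have hqub : q u ≠ b := fun h => hnot u (h ▸ hb)
  have ha'b : a' ≠ b := by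
    rintro rfl
    exact three hb.symm ha'.symm hqa.symm ha.ne (hqne u).symm hqua.symm
  have hb'a : b' ≠ a := by
    rintro rfl
    exact three ha.symm hb'.symm hqb.symm hb.ne (hqne u).symm hqub.symm
  refine hc.nonempty_iso_of_injective_hom hreg isRegularOfDegree_cycleGraph_six
    ![u, a, a', q u, b', b] ?_ ?_
  · intro i j
    fin_cases i <;> fin_cases j <;>
      simp [ha.ne, ha.ne', hb.ne, hb.ne', hba, Ne.symm hba, hau, Ne.symm hau, hbu, Ne.symm hbu,
        hab', hab'.symm, hqua, hqua.symm, hqub, hqub.symm, ha'b, ha'b.symm, hb'a, hb'a.symm,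
        hqne u, (hqne u).symm, ha'.ne, ha'.ne', hb'.ne, hb'.ne', hqa.ne, hqa.ne', hqb.ne, hqb.ne']
  · intro i j
    fin_cases i <;> fin_cases j <;>
      simp [cycleGraph_adj, ha, ha.symm, hb, hb.symm, ha', ha'.symm, hb', hb'.symm, hqa,
        hqa.symm, hqb, hqb.symm] <;> exact fun h => absurd h (by decide)

end Classification

/-! ### From perfect state transfer to the four graphs -/

section Necessity

variable {V : Type*} [Fintype V] [DecidableEq V] {G : SimpleGraph V} [DecidableRel G.Adj]

theorem eq_two_or_four_of_mem {k : ℕ} (hk : 0 < k) {q : ℚ} (h : (-2 / k : ℂ) = q)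
    (hq : (q : ℂ) = -1 ∨ (q : ℂ) = -(1 / 2) ∨ (q : ℂ) = 0 ∨ (q : ℂ) = 1 / 2 ∨ (q : ℂ) = 1) :
    k = 2 ∨ k = 4 := by
  have hk0 : (k : ℂ) ≠ 0 := by exact_mod_cast hk.ne'
  rw [← h] at hq
  rcases hq with hq | hq | hq | hq | hq <;> field_simp at hq
  · left
    have : (k : ℂ) = (2 : ℕ) := by push_cast; linear_combination hq
    exact_mod_cast this
  · right
    have : (k : ℂ) = (4 : ℕ) := by push_cast; linear_combination hq
    exact_mod_cast this
  · norm_num at hq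
  · have : ((k + 4 : ℕ) : ℂ) = (0 : ℕ) := by push_cast; linear_combination -hq
    have : k + 4 = 0 := by exact_mod_cast this
    omega
  · have : ((k + 2 : ℕ) : ℂ) = (0 : ℕ) := by push_cast; linear_combination -hq
    have : k + 2 = 0 := by exact_mod_cast this
    omega

theorem IsDistanceRegular.nonempty_iso_of_even (hdr : G.IsDistanceRegular)
    (hint : G.IsIntegralGraph) {k : ℕ} (hk : 0 < k) (hreg : G.IsRegularOfDegree k) {τ : ℕ}
    (hτ : 0 < τ) (he : Even τ) {q : V → V} (hq : Function.Involutive q) (hqne : ∀ x, q x ≠ x)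
    {i : ℕ} (hdist : ∀ x y, G.dist x y = i ↔ y = q x)
    (hM : aeval ((k : ℂ)⁻¹ • G.adjMatrix ℂ) (Chebyshev.T ℂ τ)
      = Matrix.of fun x y => if y = q x then 1 else 0) :
    Nonempty (G ≃g cycleGraph 4) ∨
      Nonempty (G ≃g completeMultipartiteGraph (fun _ : Fin 3 => Fin 2)) := by
  have hk0 : (k : ℂ) ≠ 0 := by exact_mod_cast hk.ne'
  obtain ⟨u⟩ := hdr.1.nonempty
  have hsq := involutionMatrix_mul_self hq
  rw [← hM] at hsq
  have h0 : aeval ((k : ℂ)⁻¹ • G.adjMatrix ℂ) (X * (Chebyshev.T ℂ τ - 1)) = 0 := by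
    refine (isHermitian_smul_adjMatrix k).aeval_eq_zero _ fun μ x hx hμ => ?_
    obtain ⟨r, rfl⟩ := hint.exists_rat_eq_of_mulVec hk hx hμ
    have := Chebyshev.mul_eval_T_sub_one_of_even hτ he (eval_sq_eq_one_of_aeval_sq_eq_one hsq hx hμ)
    simpa using this
  have htwin (x y : V) : G.Adj x (q y) ↔ G.Adj x y := by
    have h1 := congrFun (congrFun h0 x) y
    rw [map_mul, aeval_X, map_sub, hM, map_one, mul_sub, mul_one, smul_mul_assoc, ← smul_sub,
      Matrix.smul_apply, Matrix.zero_apply, smul_eq_zero_iff_right (inv_ne_zero hk0),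
      Matrix.sub_apply, sub_eq_zero, Matrix.mul_apply, Finset.sum_eq_single (q y)] at h1
    · by_cases ha : G.Adj x (q y) <;> by_cases hb : G.Adj x y <;> simp_all [hq y]
    · intro z _ hz
      have : y ≠ q z := fun h => hz (by rw [h, hq])
      simp [this]
    · simp
  have hadj := hdr.1.adj_iff_of_twins hk hreg hqne hdist htwin
  obtain ⟨z, hz, hPz⟩ := exists_eigenvector_of_cocktailParty hk hreg hq hqne hadj u
  obtain ⟨r, hr⟩ := hint.exists_rat_eq_of_mulVec hk hz hPz
  have hr' := eval_sq_eq_one_of_aeval_sq_eq_one hsq hz hPz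
  rw [hr] at hr'
  exact hdr.1.nonempty_iso_of_cocktailParty
    (eq_two_or_four_of_mem hk hr (Chebyshev.mem_of_eval_T_sq_eq_one hτ hr')) hreg hq hqne hadj u

theorem IsDistanceRegular.nonempty_iso_of_odd (hdr : G.IsDistanceRegular)
    (hint : G.IsIntegralGraph) {k : ℕ} (hk : 0 < k) (hreg : G.IsRegularOfDegree k) {τ : ℕ}
    (hτ : 0 < τ) (ho : Odd τ) {q : V → V} (hq : Function.Involutive q) (hqne : ∀ x, q x ≠ x)
    {i : ℕ} (hdist : ∀ x y, G.dist x y = i ↔ y = q x)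
    (hM : aeval ((k : ℂ)⁻¹ • G.adjMatrix ℂ) (Chebyshev.T ℂ τ)
      = Matrix.of fun x y => if y = q x then 1 else 0) :
    Nonempty (G ≃g completeGraph (Fin 2)) ∨ Nonempty (G ≃g cycleGraph 6) := by
  have hk0 : (k : ℂ) ≠ 0 := by exact_mod_cast hk.ne'
  obtain ⟨u⟩ := hdr.1.nonempty
  by_cases hi : i = 1
  · left
    subst hi
    have hu : G.neighborFinset u = {q u} := by
      ext y
      rw [mem_neighborFinset, ← dist_eq_one_iff_adj, hdist, Finset.mem_singleton]
    have : k = 1 := by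
      rw [← hreg.degree_eq u, ← card_neighborFinset_eq_degree, hu, Finset.card_singleton]
    exact hdr.1.nonempty_iso_completeGraph_two (this ▸ hreg) u
  right
  have hnot (x : V) : ¬G.Adj x (q x) := fun h =>
    hi (((hdist x (q x)).2 rfl).symm.trans (dist_eq_one_iff_adj.2 h))
  have hsq := involutionMatrix_mul_self hq
  rw [← hM] at hsq
  have h0 : aeval ((k : ℂ)⁻¹ • G.adjMatrix ℂ) (Chebyshev.T ℂ τ * X - (2 * X ^ 2 - 1)) = 0 := by
    refine (isHermitian_smul_adjMatrix k).aeval_eq_zero _ fun μ x hx hμ => ?_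
    obtain ⟨r, rfl⟩ := hint.exists_rat_eq_of_mulVec hk hx hμ
    obtain ⟨h1, h2⟩ := Chebyshev.eval_T_of_odd hτ ho (eval_sq_eq_one_of_aeval_sq_eq_one hsq hx hμ)
    simp only [eval_sub, eval_mul, eval_X, h1, eval_ofNat, eval_pow, eval_one]
    linear_combination h2
  -- The entries of `M P = 2 P² - 1`, multiplied by `k²`.
  have hentry (x y : V) : (if G.Adj (q x) y then 1 else 0 : ℂ) * k
      = 2 * ((Finset.univ.filter fun z => G.Adj x z ∧ G.Adj z y).card : ℂ)
        - (if x = y then 1 else 0) * k ^ 2 := by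
    have h1 := congrFun (congrFun h0 x) y
    rw [map_sub, map_mul, map_sub, map_mul, map_pow, aeval_X, hM, map_one, map_ofNat,
      Matrix.sub_apply, Matrix.zero_apply, sub_eq_zero, Matrix.mul_apply,
      Finset.sum_eq_single (q x) (fun z _ hz => by simp [hz]) (by simp), pow_two,
      smul_mul_smul_comm, Matrix.sub_apply, two_mul, Matrix.add_apply, Matrix.smul_apply,
      Matrix.smul_apply, sq_adjMatrix_apply, adjMatrix_apply, Matrix.of_apply, if_pos rfl,
      Matrix.one_apply, smul_eq_mul, smul_eq_mul] at h1
    field_simp at h1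
    linear_combination h1
  have hk2 : k = 2 := by
    have h1 := hentry u u
    have h2 : (Finset.univ.filter fun z => G.Adj u z ∧ G.Adj z u).card = k := by
      rw [← hreg.degree_eq u, ← card_neighborFinset_eq_degree, neighborFinset_eq_filter]
      congr 1
      ext z
      simp [adj_comm]
    rw [if_neg (fun h => hnot u h.symm), if_pos rfl, h2] at h1
    have : (k : ℂ) = (2 : ℕ) := by
      push_cast
      exact mul_left_cancel₀ hk0 (by linear_combination h1)
    exact_mod_cast this
  subst hk2
  refine hdr.1.nonempty_iso_cycleGraph_six hreg hqne hnot (fun x y hxy => ?_) u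
  have h1 := hentry x y
  rw [if_neg hxy] at h1
  have : (((Finset.univ.filter fun z => G.Adj x z ∧ G.Adj z y).card : ℕ) : ℂ)
      = ((if G.Adj (q x) y then 1 else 0 : ℕ) : ℂ) := by
    push_cast at h1 ⊢
    linear_combination (-1 / 2 : ℂ) * h1
  exact_mod_cast this

theorem IsDistanceRegular.nonempty_iso_of_hasGroverPST (hdr : G.IsDistanceRegular)
    (hint : G.IsIntegralGraph) (h : G.HasGroverPST) :
    Nonempty (G ≃g completeGraph (Fin 2)) ∨ Nonempty (G ≃g cycleGraph 4) ∨
      Nonempty (G ≃g cycleGraph 6) ∨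
      Nonempty (G ≃g completeMultipartiteGraph (fun _ : Fin 3 => Fin 2)) := by
  obtain ⟨u, v, τ, huv, hτ, γ, hγ, h⟩ := h
  obtain ⟨k, hreg⟩ := hdr.exists_isRegularOfDegree
  have hk : 0 < k := by
    have : Nontrivial V := ⟨u, v, huv⟩
    rw [← hreg.degree_eq u]
    exact hdr.1.preconnected.degree_pos_of_nontrivial u
  obtain ⟨q, i, hq, hqne, hdist, hM⟩ := hdr.exists_involutive hk hreg huv hγ
    (Chebyshev.T_eval_one ℂ τ) (aeval_T_mulVec_of_perfectStateTransfer hk hreg h)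
  rcases Nat.even_or_odd τ with he | ho
  · rcases hdr.nonempty_iso_of_even hint hk hreg hτ he hq hqne hdist hM with h | h
    · exact Or.inr (Or.inl h)
    · exact Or.inr (Or.inr (Or.inr h))
  · rcases hdr.nonempty_iso_of_odd hint hk hreg hτ ho hq hqne hdist hM with h | h
    · exact Or.inl h
    · exact Or.inr (Or.inr (Or.inl h))

end Necessity

/-! ### Perfect state transfer on the four graphs -/

section Sufficiency

variable {V W : Type*} [Fintype V] [DecidableEq V] {G : SimpleGraph V} [DecidableRel G.Adj]
  [Fintype W] [DecidableEq W] {H : SimpleGraph W} [DecidableRel H.Adj]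

/-- If a Chebyshev polynomial of the normalized adjacency matrix of a regular graph `H` maps a
standard basis vector to another one, then the graphs isomorphic to `H` exhibit perfect state
transfer. -/
theorem hasGroverPST_of_iso {k : ℕ} (hk : 0 < k) (hH : H.IsRegularOfDegree k) (e : G ≃g H)
    {u v : W} (huv : u ≠ v) {τ : ℕ} (hτ : 0 < τ)
    (h : ∀ x, aeval ((k : ℂ)⁻¹ • H.adjMatrix ℂ) (Chebyshev.T ℂ τ) x u = if x = v then 1 else 0) :
    G.HasGroverPST := by
  have hG : G.IsRegularOfDegree k := fun x => by rw [← e.degree_eq, hH.degree_eq]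
  have hA : (k : ℂ)⁻¹ • G.adjMatrix ℂ
      = Matrix.reindexAlgEquiv ℂ ℂ e.toEquiv.symm ((k : ℂ)⁻¹ • H.adjMatrix ℂ) := by
    ext x y
    simp [Matrix.coe_reindexAlgEquiv, adjMatrix_apply, e.map_adj_iff]
  refine ⟨e.symm u, e.symm v, τ, perfectStateTransferAt_of_aeval_T_mulVec hk hG
    (e.symm.injective.ne huv) hτ ?_⟩
  rw [hA, ← AlgEquiv.coe_toAlgHom, aeval_algHom_apply]
  ext x
  have := h (e x)
  simp only [Matrix.mulVec_single_one, Matrix.col_apply, AlgEquiv.coe_toAlgHom,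
    Matrix.coe_reindexAlgEquiv, Matrix.reindex_apply, Matrix.submatrix_apply]
  have he : (e x = v) ↔ x = e.symm v := ⟨fun h => by simp [← h], fun h => by simp [h]⟩
  simpa [Pi.single_apply, he] using this

omit [Fintype W] [DecidableEq W] in
-- Moves powers of the adjacency matrix to `ℤ`, where `decide` can evaluate them.
theorem map_adjMatrix_intCast : (H.adjMatrix ℤ).map (Int.castRingHom ℂ) = H.adjMatrix ℂ := by
  ext x y
  simp [adjMatrix_apply, apply_ite]

theorem hasGroverPST_of_iso_completeGraph_two (e : G ≃g completeGraph (Fin 2)) :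
    G.HasGroverPST := by
  refine hasGroverPST_of_iso one_pos isRegularOfDegree_completeGraph_two e (u := 0) (v := 1)
    (by decide) one_pos fun x => ?_
  fin_cases x <;> simp

theorem adjMatrix_pow_intCast_apply (n : ℕ) (x y : W) :
    (H.adjMatrix ℂ ^ n) x y = ((H.adjMatrix ℤ ^ n) x y : ℤ) := by
  rw [← map_adjMatrix_intCast, ← Matrix.map_pow]
  simp

theorem hasGroverPST_of_iso_cycleGraph_four (e : G ≃g cycleGraph 4) : G.HasGroverPST := by
  refine hasGroverPST_of_iso two_pos isRegularOfDegree_cycleGraph_four e (u := 0) (v := 2)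
    (by decide) two_pos fun x => ?_
  have h : ∀ x, ((cycleGraph 4).adjMatrix ℤ ^ 2) x 0
      = 2 * (if x = 2 then 1 else 0) + 2 * (if x = 0 then 1 else 0) := by decide
  have h' := congrArg (Int.cast : ℤ → ℂ) (h x)
  rw [← adjMatrix_pow_intCast_apply] at h'
  push_cast at h'
  have hT : Chebyshev.T ℂ ((2 : ℕ) : ℤ) = (2 : ℂ) • X ^ 2 - 1 := by
    rw [Nat.cast_ofNat, Chebyshev.T_two, smul_eq_C_mul, map_ofNat]
  simp only [hT, map_sub, map_smul, map_pow, aeval_X, map_one, _root_.smul_pow, Matrix.sub_apply,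
    Matrix.smul_apply, h', Matrix.one_apply, smul_eq_mul]
  push_cast
  ring

theorem T_three_eq : Chebyshev.T ℂ 3 = 4 * X ^ 3 - 3 * X := by
  have := Chebyshev.T_add_two ℂ 1
  rw [show (1 : ℤ) + 2 = 3 by norm_num, one_add_one_eq_two, Chebyshev.T_two,
    Chebyshev.T_one] at this
  rw [this]
  ring

theorem hasGroverPST_of_iso_cycleGraph_six (e : G ≃g cycleGraph 6) : G.HasGroverPST := by
  refine hasGroverPST_of_iso two_pos isRegularOfDegree_cycleGraph_six e (u := 0) (v := 3)
    (by decide) three_pos fun x => ?_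
  have h : ∀ x, ((cycleGraph 6).adjMatrix ℤ ^ 3) x 0
      = 3 * ((cycleGraph 6).adjMatrix ℤ ^ 1) x 0 + 2 * (if x = 3 then 1 else 0) := by decide
  have h' := congrArg (Int.cast : ℤ → ℂ) (h x)
  push_cast at h'
  rw [← adjMatrix_pow_intCast_apply, ← adjMatrix_pow_intCast_apply, pow_one] at h'
  have hT : Chebyshev.T ℂ ((3 : ℕ) : ℤ) = (4 : ℂ) • X ^ 3 - (3 : ℂ) • X := by
    rw [Nat.cast_ofNat, T_three_eq, smul_eq_C_mul, smul_eq_C_mul, map_ofNat, map_ofNat]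
  simp only [hT, map_sub, map_smul, map_pow, aeval_X, _root_.smul_pow, Matrix.sub_apply,
    Matrix.smul_apply, h', smul_eq_mul]
  push_cast
  ring

theorem hasGroverPST_of_iso_completeMultipartiteGraph
    (e : G ≃g completeMultipartiteGraph (fun _ : Fin 3 => Fin 2)) : G.HasGroverPST := by
  refine hasGroverPST_of_iso four_pos isRegularOfDegree_completeMultipartiteGraph_three_two e
    -- The eigenvalues of `A / 4` are `1`, `0`, `-1/2`. `T_6` takes the values `1`, `-1`, `1` there,
    -- exactly those of the swap within parts.
    (u := ⟨0, 0⟩) (v := ⟨0, 1⟩) (by decide) (show 0 < 6 by norm_num) fun x => ?_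
  let M (a b : ℤ) : Matrix (Σ _ : Fin 3, Fin 2) (Σ _ : Fin 3, Fin 2) ℤ :=
    Matrix.of fun x y => if x.1 = y.1 then a else b
  have h2 : (completeMultipartiteGraph (fun _ : Fin 3 => Fin 2)).adjMatrix ℤ ^ 2 = M 4 2 := by
    decide
  have h4 : (completeMultipartiteGraph (fun _ : Fin 3 => Fin 2)).adjMatrix ℤ ^ 4 = M 48 40 := by
    rw [show 4 = 2 + 2 by norm_num, pow_add, h2]
    decide
  have h6 : (completeMultipartiteGraph (fun _ : Fin 3 => Fin 2)).adjMatrix ℤ ^ 6 = M 704 672 := by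
    rw [show 6 = 4 + 2 by norm_num, pow_add, h2, h4]
    decide
  have hT : Chebyshev.T ℂ ((6 : ℕ) : ℤ)
      = (32 : ℂ) • X ^ 6 - (48 : ℂ) • X ^ 4 + (18 : ℂ) • X ^ 2 - 1 := by
    -- `2 T_3² = T_6 + T_0`.
    have := Chebyshev.T_mul_T ℂ 3 3
    rw [show (3 : ℤ) + 3 = 6 by norm_num, sub_self, Chebyshev.T_zero, T_three_eq] at this
    simp only [smul_eq_C_mul, Nat.cast_ofNat, map_ofNat]
    linear_combination -1 * this
  simp only [hT, map_sub, map_add, map_smul, map_pow, aeval_X, map_one, _root_.smul_pow,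
    Matrix.sub_apply, Matrix.add_apply, Matrix.smul_apply, adjMatrix_pow_intCast_apply, h2, h4, h6,
    Matrix.one_apply, smul_eq_mul, M, Matrix.of_apply]
  obtain ⟨i, j⟩ := x
  fin_cases i <;> fin_cases j <;> norm_num

end Sufficiency

end SimpleGraph

theorem theorem4p8 {V : Type*} [Fintype V] [DecidableEq V] (G : SimpleGraph V)
    [DecidableRel G.Adj] (hint : G.IsIntegralGraph) (hdr : G.IsDistanceRegular) :
    G.HasGroverPST ↔
      Nonempty (G ≃g SimpleGraph.completeGraph (Fin 2)) ∨
      Nonempty (G ≃g SimpleGraph.cycleGraph 4) ∨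
      Nonempty (G ≃g SimpleGraph.cycleGraph 6) ∨
      Nonempty (G ≃g SimpleGraph.completeMultipartiteGraph (fun _ : Fin 3 => Fin 2)) := by
  refine ⟨hdr.nonempty_iso_of_hasGroverPST hint, ?_⟩
  rintro (⟨⟨e⟩⟩ | ⟨⟨e⟩⟩ | ⟨⟨e⟩⟩ | ⟨⟨e⟩⟩)
  · exact SimpleGraph.hasGroverPST_of_iso_completeGraph_two e
  · exact SimpleGraph.hasGroverPST_of_iso_cycleGraph_four e
  · exact SimpleGraph.hasGroverPST_of_iso_cycleGraph_six e
  · exact SimpleGraph.hasGroverPST_of_iso_completeMultipartiteGraph e
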